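/- Let $0<\alpha<1$. Let $\mathcal S_+$ be the space of complex-valued smooth functions $\varphi$ on $[0,\infty)$ that, with all derivatives, decay rapidly at infinity and satisfy $\varphi^{(l)}(0)=0$ for $l=0,1,2,\dots$. Let $$\Phi_+^{1-\alpha}=\Big\{\varphi\in\mathcal S_+:\ \int_0^\infty \varphi(x)\,x^{1-\alpha-k}\,dx=0,\ k=1,2,\dots\Big\}$$ with the topology induced by the Schwartz space, and let $(\Phi_+^{1-\alpha})'$ be its space of continuous linear functionals. A function $f$ on $(0,\infty)$ of at most power-like growth near $0$ and $\infty$ is identified with the distribution $\varphi\mapsto\int_0^\infty f(t)\varphi(t)\,dt$. Put $$(I_-^{1-\alpha}\varphi)(t)=\frac1{\Gamma(1-\alpha)}\int_t^\infty(\tau-t)^{-\alpha}\varphi(\tau)\,d\tau ,\qquad t>0.$$ For $u\in C^1(0,\infty)$ whose derivative has at most power-like growth near $0$ and $\infty$, the Caputo--Dzhrbashyan derivative $D_*^\alpha u\in(\Phi_+^{1-\alpha})'$ is defined by $$\langle D_*^\alpha u,\varphi\rangle=\int_0^\infty u'(x)\,(I_-^{1-\alpha}\varphi)(x)\,dx,\qquad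 \varphi\in\Phi_+^{1-\alpha}.$$ (i) If $\mu<0$ and $\mu\neq-1,-2,\dots$, then in $(\Phi_+^{1-\alpha})'$ $$D_*^\alpha t^\mu=\frac{\Gamma(\mu+1)}{\Gamma(\mu+1-\alpha)}\,t^{\mu-\alpha},$$ where $1/\Gamma(z)$ is read as $0$ at the poles $z=0,-1,-2,\dots$ of $\Gamma$. (ii) If $k\geq1$ is an integer, then in $(\Phi_+^{1-\alpha})'$ $$D_*^\alpha t^{-k}=\frac{(-1)^{k-1}}{(k-1)!\,\Gamma(-k+1-\alpha)}\,t^{-k-\alpha}\log t .$$ In particular, all the integrals involved converge absolutely and the functionals are continuous. -/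

import Mathlib

/-- The space `S₊` of Schwartz functions on `[0, ∞)` all of whose derivatives vanish at `0`.
Extension by zero to the negative half-axis identifies it, together with its topology, with the
space of Schwartz functions on `ℝ` that vanish on `(-∞, 0]`. -/
def schwartzPlus : Submodule ℂ (SchwartzMap ℝ ℂ) where
  carrier := {φ | ∀ x : ℝ, x ≤ 0 → φ x = 0}
  add_mem' := by
    intro a b ha hb x hx
    simp [ha x hx, hb x hx]
  zero_mem' := by
    intro x _
    simp
  smul_mem' := by
    intro c a ha x hx
    simp [ha x hx]

theorem schwartzPlus_iteratedDeriv_zero {φ : SchwartzMap ℝ ℂ} (hφ : φ ∈ schwartzPlus) (n : ℕ) :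
    iteratedDeriv n φ 0 = 0 := by
  have hneg : ∀ m : ℕ, ∀ x : ℝ, x < 0 → iteratedDeriv m φ x = 0 := by
    intro m
    induction m with
    | zero =>
      intro x hx
      simpa using hφ x hx.le
    | succ m ih =>
      intro x hx
      rw [iteratedDeriv_succ]
      have h : iteratedDeriv m φ =ᶠ[nhds x] fun _ => (0 : ℂ) := by
        filter_upwards [Iio_mem_nhds hx] with y hy using ih y hy
      rw [h.deriv_eq]
      simp
  have hc : Continuous (iteratedDeriv n φ) :=
    (φ.smooth ⊤).continuous_iteratedDeriv n (by exact_mod_cast le_top)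
  have hcl : IsClosed {x : ℝ | iteratedDeriv n φ x = 0} := isClosed_eq hc continuous_const
  have hsub : closure (Set.Iio (0 : ℝ)) ⊆ {x : ℝ | iteratedDeriv n φ x = 0} :=
    hcl.closure_subset_iff.2 fun x hx => hneg n x hx
  rw [closure_Iio] at hsub
  exact hsub (Set.mem_Iic.2 le_rfl)

theorem schwartzPlus_bound_aux {φ : SchwartzMap ℝ ℂ} (hφ : φ ∈ schwartzPlus) (n : ℕ) :
    ∀ m : ℕ, ∃ C : ℝ, 0 ≤ C ∧ ∀ x : ℝ, 0 ≤ x → ‖iteratedDeriv m φ x‖ ≤ C * x ^ n := by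
  induction n with
  | zero =>
    intro m
    obtain ⟨C, hC0, hC⟩ := φ.decay 0 m
    refine ⟨C, hC0.le, fun x _ => ?_⟩
    simpa [norm_iteratedFDeriv_eq_norm_iteratedDeriv] using hC x
  | succ n ih =>
    intro m
    obtain ⟨C, hC0, hC⟩ := ih (m + 1)
    refine ⟨C, hC0, fun x hx => ?_⟩
    have hd : ∀ y : ℝ, HasDerivAt (iteratedDeriv m φ) (iteratedDeriv (m + 1) φ y) y := by
      intro y
      rw [iteratedDeriv_succ]
      exact ((φ.smooth ⊤).differentiable_iteratedDeriv m
        (by exact_mod_cast WithTop.coe_lt_top _) y).hasDerivAt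
    have h := norm_image_sub_le_of_norm_deriv_le_segment' (a := 0) (b := x)
      (f := iteratedDeriv m φ) (f' := iteratedDeriv (m + 1) φ) (C := C * x ^ n)
      (fun y _ => (hd y).hasDerivWithinAt)
      (fun y hy => (hC y hy.1).trans
        (mul_le_mul_of_nonneg_left (pow_le_pow_left₀ hy.1 hy.2.le n) hC0))
      x (Set.right_mem_Icc.2 hx)
    rw [schwartzPlus_iteratedDeriv_zero hφ, sub_zero, sub_zero] at h
    rw [pow_succ, ← mul_assoc]
    exact h

/-- All the moments `∫₀^∞ φ(x) x^s dx`, `s` real, of a function from `S₊` converge absolutely. -/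
theorem schwartzPlus_integrableOn_moment {φ : SchwartzMap ℝ ℂ} (hφ : φ ∈ schwartzPlus) (s : ℝ) :
    MeasureTheory.IntegrableOn (fun x : ℝ => φ x * ((x ^ s : ℝ) : ℂ)) (Set.Ioi 0) := by
  have hcont : ContinuousOn (fun x : ℝ => φ x * ((x ^ s : ℝ) : ℂ)) (Set.Ioi 0) := by
    refine φ.continuous.continuousOn.mul (Complex.continuous_ofReal.comp_continuousOn ?_)
    exact fun x hx => (Real.continuousAt_rpow_const x s (Or.inl (ne_of_gt hx))).continuousWithinAt
  have hmeas := hcont.aestronglyMeasurable (μ := MeasureTheory.volume) measurableSet_Ioi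
  rw [← Set.Ioc_union_Ioi_eq_Ioi (zero_le_one' ℝ)]
  refine MeasureTheory.IntegrableOn.union ?_ ?_
  · obtain ⟨n, hn⟩ := exists_nat_ge (-s)
    obtain ⟨C, hC0, hC⟩ := schwartzPlus_bound_aux hφ n 0
    have hi : MeasureTheory.IntegrableOn (fun _ : ℝ => C) (Set.Ioc (0 : ℝ) 1) :=
      MeasureTheory.integrableOn_const (by simp)
    refine MeasureTheory.Integrable.mono' hi
      (hmeas.mono_set Set.Ioc_subset_Ioi_self) ?_
    refine (MeasureTheory.ae_restrict_iff' measurableSet_Ioc).2 (Filter.Eventually.of_forall ?_)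
    intro x hx
    have h1 := hC x hx.1.le
    rw [iteratedDeriv_zero] at h1
    rw [norm_mul, Complex.norm_real, Real.norm_of_nonneg (Real.rpow_nonneg hx.1.le s)]
    calc ‖φ x‖ * x ^ s ≤ C * x ^ n * x ^ s :=
          mul_le_mul_of_nonneg_right h1 (Real.rpow_nonneg hx.1.le s)
      _ = C * x ^ ((n : ℝ) + s) := by rw [Real.rpow_add hx.1, Real.rpow_natCast, mul_assoc]
      _ ≤ C * 1 := mul_le_mul_of_nonneg_left
          (Real.rpow_le_one hx.1.le hx.2 (by linarith)) hC0
      _ = C := mul_one C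
  · obtain ⟨k, hk⟩ := exists_nat_ge (s + 2)
    obtain ⟨C, -, hC⟩ := φ.decay k 0
    have hi : MeasureTheory.IntegrableOn (fun x : ℝ => C * x ^ (-2 : ℝ)) (Set.Ioi 1) :=
      (integrableOn_Ioi_rpow_of_lt (by norm_num) one_pos).const_mul C
    refine MeasureTheory.Integrable.mono' hi
      (hmeas.mono_set (Set.Ioi_subset_Ioi zero_le_one)) ?_
    refine (MeasureTheory.ae_restrict_iff' measurableSet_Ioi).2 (Filter.Eventually.of_forall ?_)
    intro x hx
    have hx1 : (1 : ℝ) < x := hx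
    have hx0 : (0 : ℝ) < x := one_pos.trans hx1
    have h1 := hC x
    rw [norm_iteratedFDeriv_zero, Real.norm_of_nonneg hx0.le] at h1
    rw [norm_mul, Complex.norm_real, Real.norm_of_nonneg (Real.rpow_nonneg hx0.le s)]
    calc ‖φ x‖ * x ^ s ≤ ‖φ x‖ * x ^ ((k : ℝ) + (-2)) :=
          mul_le_mul_of_nonneg_left
            (Real.rpow_le_rpow_of_exponent_le hx1.le (by linarith)) (norm_nonneg _)
      _ = x ^ k * ‖φ x‖ * x ^ (-2 : ℝ) := by
          rw [Real.rpow_add hx0, Real.rpow_natCast]; ring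
      _ ≤ C * x ^ (-2 : ℝ) := mul_le_mul_of_nonneg_right h1 (Real.rpow_nonneg hx0.le _)

/-- The space `Φ₊^{1-α}` of test functions: those `φ ∈ S₊` with
`∫₀^∞ φ(x) x^{1-α-k} dx = 0` for `k = 1, 2, …`, with the topology induced by the Schwartz space. -/
def fracTestSpace (α : ℝ) : Submodule ℂ (SchwartzMap ℝ ℂ) where
  carrier := {φ | φ ∈ schwartzPlus ∧
    ∀ k : ℕ, 1 ≤ k → ∫ x in Set.Ioi (0 : ℝ), φ x * ((x ^ (1 - α - (k : ℝ)) : ℝ) : ℂ) = 0}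
  add_mem' := by
    rintro a b ⟨ha, ha'⟩ ⟨hb, hb'⟩
    refine ⟨schwartzPlus.add_mem ha hb, fun k hk => ?_⟩
    have h := MeasureTheory.integral_add
      (schwartzPlus_integrableOn_moment ha (1 - α - (k : ℝ)))
      (schwartzPlus_integrableOn_moment hb (1 - α - (k : ℝ)))
    rw [ha' k hk, hb' k hk, add_zero] at h
    simpa only [add_apply, add_mul] using h
  zero_mem' := ⟨schwartzPlus.zero_mem, fun k _ => by simp⟩
  smul_mem' := by
    rintro c a ⟨ha, ha'⟩
    refine ⟨schwartzPlus.smul_mem c ha, fun k hk => ?_⟩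
    simp only [smul_apply, smul_eq_mul, mul_assoc]
    rw [MeasureTheory.integral_const_mul, ha' k hk, mul_zero]

/-- The space `(Φ₊^{1-α})'` of distributions: continuous linear functionals on `Φ₊^{1-α}`. -/
abbrev FracDistribution (α : ℝ) : Type := fracTestSpace α →L[ℂ] ℂ

/-- The right-sided fractional integral
`(I₋^β φ)(t) = Γ(β)⁻¹ ∫_t^∞ (τ - t)^{β-1} φ(τ) dτ`. -/
noncomputable def fracIntegralRight (β : ℝ) (φ : ℝ → ℂ) (t : ℝ) : ℂ :=
  ((Real.Gamma β : ℝ) : ℂ)⁻¹ * ∫ τ in Set.Ioi t, (((τ - t) ^ (β - 1) : ℝ) : ℂ) * φ τ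

/-- `R` is the (regular) distribution given by the function `f` on `(0, ∞)`:
`⟨R, φ⟩ = ∫₀^∞ f(t) φ(t) dt`, an absolutely convergent integral, for all test functions. -/
def IsGivenByFunction (α : ℝ) (f : ℝ → ℂ) (R : FracDistribution α) : Prop :=
  ∀ φ : fracTestSpace α,
    MeasureTheory.IntegrableOn (fun t : ℝ => f t * φ.1 t) (Set.Ioi 0) ∧
    R φ = ∫ t in Set.Ioi (0 : ℝ), f t * φ.1 t

/-- `T` is the Caputo–Dzhrbashyan derivative of order `α` of `u` in the sense of distributions:
`u` is continuously differentiable on `(0, ∞)`, its derivative has at most power-like growth near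
zero and infinity, and `⟨T, φ⟩ = ∫₀^∞ u'(x) (I₋^{1-α} φ)(x) dx`, an absolutely convergent integral,
for all test functions `φ`. -/
def IsCaputoDerivative (α : ℝ) (u : ℝ → ℂ) (T : FracDistribution α) : Prop :=
  ContDiffOn ℝ 1 u (Set.Ioi 0) ∧
  (∃ C N : ℝ, ∀ x : ℝ, 0 < x → ‖deriv u x‖ ≤ C * (x ^ N + x ^ (-N))) ∧
  ∀ φ : fracTestSpace α,
    MeasureTheory.IntegrableOn
      (fun x : ℝ => deriv u x * fracIntegralRight (1 - α) φ.1 x) (Set.Ioi 0) ∧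
    T φ = ∫ x in Set.Ioi (0 : ℝ), deriv u x * fracIntegralRight (1 - α) φ.1 x

/-! Write `J φ (t) = ∫₀^∞ s^{-α} φ(s+t) ds`, so that `I₋^{1-α} φ = J φ / Γ(1-α)`, and let `M` be the
Mellin transform. Pairing `D_*^α t^μ` with `φ` gives `μ / Γ(1-α) · M(Jφ)(μ)`, while `t^{μ-α}` pairs
with `φ` to `Mφ(μ+1-α)`. So everything reduces to relating `M(Jφ)` to `Mφ`.

For `Re s > 0`, Fubini and the Beta integral give `M(Jφ)(s) = B(s, 1-α) Mφ(s+1-α)`, that is,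
`M(Jφ)(s)/Γ(s) = Γ(1-α) Mφ(s+1-α)/Γ(s+1-α)`. Both sides of the second form are entire: `φ` is flat
at `0`, and the moment conditions say exactly that `Jφ` is flat at `0` too, since `(Jφ)^{(n)}(0)` is
a multiple of the moment of order `-α-n`. The identity theorem extends the relation to all `s`
(`inv_Gamma_mul_mellin_shiftIntegral`).

If `μ` is not a pole of `Γ`, multiplying by `Γ(μ)` gives (i). At `s = -k` both sides vanish, and
comparing their derivatives gives (ii): `1/Γ` contributes `(-1)^k k!` on the left, and
differentiating `Mφ` produces the logarithm on the right. -/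

open MeasureTheory Set Filter Topology

/-! ### Rapid decay and entire Mellin transforms -/

/-- Functions on `(0, ∞)` that are continuous and decay faster than every power at `0` and `∞`. -/
def RapidlyDecaying (f : ℝ → ℂ) : Prop :=
  ContinuousOn f (Ioi 0) ∧
    ∀ n : ℕ, ∃ C : ℝ, ∀ x : ℝ, 0 < x → ‖f x‖ ≤ C * x ^ n ∧ x ^ n * ‖f x‖ ≤ C

theorem rapidlyDecaying_of_mem_schwartzPlus {φ : SchwartzMap ℝ ℂ} (hφ : φ ∈ schwartzPlus) :
    RapidlyDecaying φ := by
  refine ⟨φ.continuous.continuousOn, fun n => ?_⟩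
  obtain ⟨C, -, hC⟩ := schwartzPlus_bound_aux hφ n 0
  obtain ⟨D, -, hD⟩ := φ.decay n 0
  refine ⟨max C D, fun x hx => ⟨?_, ?_⟩⟩
  · have h := hC x hx.le
    rw [iteratedDeriv_zero] at h
    exact h.trans (mul_le_mul_of_nonneg_right (le_max_left _ _) (by positivity))
  · have h := hD x
    rw [norm_iteratedFDeriv_zero, Real.norm_of_nonneg hx.le] at h
    exact h.trans (le_max_right _ _)

namespace RapidlyDecaying

variable {f : ℝ → ℂ}

theorem isBigO_atTop (hf : RapidlyDecaying f) (a : ℝ) :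
    f =O[atTop] fun x : ℝ => x ^ (-a) := by
  obtain ⟨n, hn⟩ := exists_nat_ge a
  obtain ⟨C, hC⟩ := hf.2 n
  refine Asymptotics.IsBigO.of_bound C ?_
  filter_upwards [eventually_ge_atTop (1 : ℝ)] with x hx
  have hx0 : 0 < x := by linarith
  have h := (hC x hx0).2
  have hC0 : 0 ≤ C := le_trans (by positivity) h
  rw [Real.norm_of_nonneg (by positivity)]
  calc ‖f x‖ = x ^ n * ‖f x‖ * x ^ (-(n : ℝ)) := by
        rw [Real.rpow_neg hx0.le, Real.rpow_natCast]; field_simp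
    _ ≤ C * x ^ (-(n : ℝ)) := by gcongr
    _ ≤ C * x ^ (-a) := by gcongr

theorem isBigO_zero (hf : RapidlyDecaying f) (a : ℝ) :
    f =O[𝓝[>] 0] fun x : ℝ => x ^ (-a) := by
  obtain ⟨n, hn⟩ := exists_nat_ge (-a)
  obtain ⟨C, hC⟩ := hf.2 n
  refine Asymptotics.IsBigO.of_bound C ?_
  filter_upwards [Ioc_mem_nhdsGT (zero_lt_one' ℝ)] with x hx
  have h := (hC x hx.1).1
  have hC0 : 0 ≤ C := le_trans (mul_nonneg (pow_nonneg hx.1.le _) (norm_nonneg _)) (hC x hx.1).2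
  rw [Real.norm_of_nonneg (Real.rpow_nonneg hx.1.le _)]
  refine h.trans (mul_le_mul_of_nonneg_left ?_ hC0)
  rw [← Real.rpow_natCast]
  exact Real.rpow_le_rpow_of_exponent_ge hx.1 hx.2 hn

/-- Decay beyond every power at both ends puts each `s` strictly inside some strip of convergence,
so there is no restriction on `s`. -/
theorem hasDerivAt_mellin (hf : RapidlyDecaying f) (s : ℂ) :
    MellinConvergent (fun t => Real.log t • f t) s ∧
      HasDerivAt (mellin f) (mellin (fun t => Real.log t • f t) s) s :=
  mellin_hasDerivAt_of_isBigO_rpow (hf.1.locallyIntegrableOn measurableSet_Ioi)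
    (hf.isBigO_atTop (s.re + 1)) (by linarith) (hf.isBigO_zero (s.re - 1)) (by linarith)

theorem mellinConvergent (hf : RapidlyDecaying f) (s : ℂ) : MellinConvergent f s :=
  mellinConvergent_of_isBigO_rpow (hf.1.locallyIntegrableOn measurableSet_Ioi)
    (hf.isBigO_atTop (s.re + 1)) (by linarith) (hf.isBigO_zero (s.re - 1)) (by linarith)

theorem differentiable_mellin (hf : RapidlyDecaying f) : Differentiable ℂ (mellin f) :=
  fun s => (hf.hasDerivAt_mellin s).2.differentiableAt

end RapidlyDecaying

/-! ### Stability of the test space under differentiation -/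

theorem derivCLM_mem_schwartzPlus {φ : SchwartzMap ℝ ℂ} (hφ : φ ∈ schwartzPlus) :
    SchwartzMap.derivCLM ℂ ℂ φ ∈ schwartzPlus := by
  intro x hx
  rw [SchwartzMap.derivCLM_apply]
  rcases hx.lt_or_eq with h | rfl
  · have h' : (φ : ℝ → ℂ) =ᶠ[𝓝 x] fun _ => (0 : ℂ) := by
      filter_upwards [Iio_mem_nhds h] with y hy using hφ y (le_of_lt hy)
    rw [h'.deriv_eq]
    simp
  · simpa using schwartzPlus_iteratedDeriv_zero hφ 1

theorem tendsto_rpow_mul_schwartzPlus {φ : SchwartzMap ℝ ℂ} (hφ : φ ∈ schwartzPlus) (a : ℝ) :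
    Tendsto (fun x : ℝ => φ x * ((x ^ a : ℝ) : ℂ)) (𝓝[>] 0) (𝓝 0) ∧
      Tendsto (fun x : ℝ => φ x * ((x ^ a : ℝ) : ℂ)) atTop (𝓝 0) := by
  have hr := rapidlyDecaying_of_mem_schwartzPlus hφ
  constructor
  · have h1 : (fun x : ℝ => φ x * ((x ^ a : ℝ) : ℂ)) =O[𝓝[>] 0] fun x : ℝ => x := by
      have h := (hr.isBigO_zero (a - 1)).mul
        (Asymptotics.isBigO_refl (fun x : ℝ => ((x ^ a : ℝ) : ℂ)) (𝓝[>] 0)).norm_right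
      refine h.congr' EventuallyEq.rfl ?_
      filter_upwards [self_mem_nhdsWithin] with x hx
      have hx : 0 < x := hx
      rw [Complex.norm_real, Real.norm_of_nonneg (Real.rpow_nonneg hx.le _), ← Real.rpow_add hx]
      simp
    exact h1.trans_tendsto (tendsto_nhdsWithin_of_tendsto_nhds tendsto_id)
  · have h1 : (fun x : ℝ => φ x * ((x ^ a : ℝ) : ℂ)) =O[atTop] fun x : ℝ => x⁻¹ := by
      have h := (hr.isBigO_atTop (a + 1)).mul
        (Asymptotics.isBigO_refl (fun x : ℝ => ((x ^ a : ℝ) : ℂ)) atTop).norm_right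
      refine h.congr' EventuallyEq.rfl ?_
      filter_upwards [eventually_gt_atTop (0 : ℝ)] with x hx
      rw [Complex.norm_real, Real.norm_of_nonneg (Real.rpow_nonneg hx.le _), ← Real.rpow_add hx]
      simp [Real.rpow_neg_one]
    exact h1.trans_tendsto tendsto_inv_atTop_zero

theorem integral_deriv_mul_rpow_schwartzPlus {φ : SchwartzMap ℝ ℂ} (hφ : φ ∈ schwartzPlus)
    (a : ℝ) :
    ∫ x in Ioi (0 : ℝ), SchwartzMap.derivCLM ℂ ℂ φ x * ((x ^ a : ℝ) : ℂ) =
      -(a * ∫ x in Ioi (0 : ℝ), φ x * ((x ^ (a - 1) : ℝ) : ℂ)) := by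
  have h := integral_Ioi_mul_deriv_eq_deriv_mul (a := (0 : ℝ)) (a' := (0 : ℂ)) (b' := (0 : ℂ))
    (u := fun x : ℝ => ((x ^ a : ℝ) : ℂ)) (u' := fun x : ℝ => ((a * x ^ (a - 1) : ℝ) : ℂ))
    (v := φ) (v' := SchwartzMap.derivCLM ℂ ℂ φ)
    (fun x hx => (Real.hasDerivAt_rpow_const (Or.inl (ne_of_gt hx))).ofReal_comp)
    (fun x _ => φ.hasDerivAt x) ?_ ?_ ?_ ?_
  · simp only [mul_comm (SchwartzMap.derivCLM ℂ ℂ φ _)]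
    rw [h, ← integral_const_mul]
    simp only [sub_zero, zero_sub]
    congr 1
    refine integral_congr_ae (Eventually.of_forall fun x => ?_)
    push_cast
    ring
  · exact (schwartzPlus_integrableOn_moment (derivCLM_mem_schwartzPlus hφ) a).congr_fun
      (fun x _ => mul_comm _ _) measurableSet_Ioi
  · refine ((schwartzPlus_integrableOn_moment hφ (a - 1)).const_mul (a : ℂ)).congr ?_
    refine Eventually.of_forall fun x => ?_
    simp only [Pi.mul_apply]
    push_cast
    ring
  · exact (tendsto_rpow_mul_schwartzPlus hφ a).1.congr fun x => mul_comm _ _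
  · exact (tendsto_rpow_mul_schwartzPlus hφ a).2.congr fun x => mul_comm _ _

/-- Integration by parts turns the `k`-th moment of `φ'` into a multiple of the `(k+1)`-st moment of
`φ`. -/
theorem derivCLM_mem_fracTestSpace {α : ℝ} {φ : SchwartzMap ℝ ℂ} (hφ : φ ∈ fracTestSpace α) :
    SchwartzMap.derivCLM ℂ ℂ φ ∈ fracTestSpace α := by
  refine ⟨derivCLM_mem_schwartzPlus hφ.1, fun k _ => ?_⟩
  have h := hφ.2 (k + 1) (by omega)
  rw [integral_deriv_mul_rpow_schwartzPlus hφ.1,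
    show 1 - α - (k : ℝ) - 1 = 1 - α - ((k + 1 : ℕ) : ℝ) by push_cast; ring, h]
  simp

/-! ### The fractional integral of a test function decays rapidly -/

/-- The unnormalised right-sided fractional integral `∫₀^∞ s^a φ(s + t) ds`. -/
noncomputable def shiftIntegral (a : ℝ) (φ : ℝ → ℂ) (t : ℝ) : ℂ :=
  ∫ s in Ioi (0 : ℝ), ((s ^ a : ℝ) : ℂ) * φ (s + t)

theorem shiftIntegral_eq_setIntegral_Ioi (a : ℝ) (φ : ℝ → ℂ) (t : ℝ) :
    shiftIntegral a φ t = ∫ τ in Ioi t, (((τ - t) ^ a : ℝ) : ℂ) * φ τ := by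
  rw [shiftIntegral, ← (measurePreserving_add_right volume t).setIntegral_preimage_emb
    (measurableEmbedding_addRight t) _ (Ioi t)]
  simp

theorem fracIntegralRight_eq_shiftIntegral (β : ℝ) (φ : ℝ → ℂ) (t : ℝ) :
    fracIntegralRight β φ t = ((Real.Gamma β : ℝ) : ℂ)⁻¹ * shiftIntegral (β - 1) φ t := by
  rw [fracIntegralRight, shiftIntegral_eq_setIntegral_Ioi]

theorem integrableOn_rpow_mul_one_add_sq_inv {a : ℝ} (ha : -1 < a) (ha' : a ≤ 0) :
    IntegrableOn (fun s : ℝ => s ^ a * ((1 + s) ^ 2)⁻¹) (Ioi 0) := by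
  have hcont : ContinuousOn (fun s : ℝ => s ^ a * ((1 + s) ^ 2)⁻¹) (Ioi 0) := by
    refine ContinuousOn.mul ?_ (ContinuousOn.inv₀ (by fun_prop) fun x hx => ?_)
    · exact fun x hx => (Real.continuousAt_rpow_const x a (Or.inl (ne_of_gt hx))).continuousWithinAt
    · have : 0 < x := hx
      positivity
  have hmeas := hcont.aestronglyMeasurable (μ := volume) measurableSet_Ioi
  rw [← Ioc_union_Ioi_eq_Ioi (zero_le_one' ℝ)]
  refine IntegrableOn.union ?_ ?_
  · have hi : IntegrableOn (fun x : ℝ => x ^ a) (Ioc 0 1) :=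
      (intervalIntegrable_iff_integrableOn_Ioc_of_le zero_le_one).1
        (intervalIntegral.intervalIntegrable_rpow' ha)
    refine Integrable.mono' hi (hmeas.mono_set Ioc_subset_Ioi_self) ?_
    refine (ae_restrict_iff' measurableSet_Ioc).2 (Eventually.of_forall fun x hx => ?_)
    have hx0 := hx.1
    rw [Real.norm_of_nonneg (by positivity)]
    exact mul_le_of_le_one_right (by positivity) (inv_le_one_of_one_le₀ (by nlinarith))
  · have hi : IntegrableOn (fun x : ℝ => x ^ (-2 : ℝ)) (Ioi 1) :=
      integrableOn_Ioi_rpow_of_lt (by norm_num) one_pos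
    refine Integrable.mono' hi (hmeas.mono_set (Ioi_subset_Ioi zero_le_one)) ?_
    refine (ae_restrict_iff' measurableSet_Ioi).2 (Eventually.of_forall fun x hx => ?_)
    have hx1 : 1 < x := hx
    have hx0 : 0 < x := by linarith
    rw [Real.norm_of_nonneg (by positivity), Real.rpow_neg hx0.le]
    refine (mul_le_of_le_one_left (by positivity)
      (Real.rpow_le_one_of_one_le_of_nonpos hx1.le ha')).trans ?_
    norm_num
    gcongr
    linarith

theorem SchwartzMap.exists_norm_le_inv_one_add_pow (φ : SchwartzMap ℝ ℂ) (n : ℕ) :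
    ∃ C : ℝ, 0 ≤ C ∧ ∀ x : ℝ, ‖φ x‖ ≤ C * ((1 + |x|) ^ n)⁻¹ := by
  have h : ∀ x : ℝ, (1 + |x|) ^ n * ‖φ x‖ ≤
      2 ^ n * (Finset.Iic (n, 0)).sup (fun m => SchwartzMap.seminorm ℂ m.1 m.2) φ := fun x => by
    have h := SchwartzMap.one_add_le_sup_seminorm_apply (𝕜 := ℂ) (m := (n, 0)) le_rfl le_rfl φ x
    rwa [norm_iteratedFDeriv_zero, Real.norm_eq_abs] at h
  refine ⟨_, le_trans (by positivity) (h 0), fun x => ?_⟩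
  rw [← div_eq_mul_inv, le_div_iff₀ (by positivity), mul_comm]
  exact h x

/-- Peetre's inequality `1 + s ≤ (1 + |t|)(1 + |s+t|)`, squared. It separates the variables, giving
an integrable majorant in `s` locally uniform in `t`. -/
theorem SchwartzMap.exists_norm_add_le (φ : SchwartzMap ℝ ℂ) :
    ∃ C : ℝ, 0 ≤ C ∧ ∀ s t : ℝ, 0 ≤ s →
      ‖φ (s + t)‖ ≤ C * (1 + |t|) ^ 2 * ((1 + s) ^ 2)⁻¹ := by
  obtain ⟨C, hC0, hC⟩ := φ.exists_norm_le_inv_one_add_pow 2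
  refine ⟨C, hC0, fun s t hs => (hC _).trans ?_⟩
  rw [mul_assoc]
  refine mul_le_mul_of_nonneg_left ?_ hC0
  rw [inv_le_comm₀ (by positivity) (by positivity), mul_inv, inv_inv, ← inv_pow, ← mul_pow]
  refine pow_le_pow_left₀ (by positivity) ?_ 2
  rw [inv_mul_le_iff₀ (by positivity)]
  have h : s ≤ |s + t| + |t| := by
    have := abs_sub_abs_le_abs_sub (s + t) t
    have h2 := abs_sub (s + t) t
    rw [add_sub_cancel_right, abs_of_nonneg hs] at h2
    exact h2
  nlinarith [abs_nonneg t, abs_nonneg (s + t), mul_nonneg (abs_nonneg t) (abs_nonneg (s + t))]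

theorem aestronglyMeasurable_rpow_mul_shift (a : ℝ) (φ : SchwartzMap ℝ ℂ) (t : ℝ) :
    AEStronglyMeasurable (fun s : ℝ => ((s ^ a : ℝ) : ℂ) * φ (s + t))
      (volume.restrict (Ioi 0)) := by
  refine ContinuousOn.aestronglyMeasurable ?_ measurableSet_Ioi
  refine (Complex.continuous_ofReal.comp_continuousOn fun x hx => ?_).mul
    (φ.continuous.comp (continuous_add_const t)).continuousOn
  exact (Real.continuousAt_rpow_const x a (Or.inl (ne_of_gt hx))).continuousWithinAt

theorem integrableOn_rpow_mul_shift {a : ℝ} (ha : -1 < a) (ha' : a ≤ 0) (φ : SchwartzMap ℝ ℂ)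
    (t : ℝ) : IntegrableOn (fun s : ℝ => ((s ^ a : ℝ) : ℂ) * φ (s + t)) (Ioi 0) := by
  obtain ⟨C, hC0, hC⟩ := φ.exists_norm_add_le
  refine Integrable.mono' ((integrableOn_rpow_mul_one_add_sq_inv ha ha').const_mul
    (C * (1 + |t|) ^ 2)) (aestronglyMeasurable_rpow_mul_shift a φ t) ?_
  refine (ae_restrict_iff' measurableSet_Ioi).2 (Eventually.of_forall fun s hs => ?_)
  have hs0 : 0 < s := hs
  rw [norm_mul, Complex.norm_real, Real.norm_of_nonneg (by positivity), mul_left_comm]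
  exact mul_le_mul_of_nonneg_left (hC s t hs0.le) (by positivity)

/-- In the shifted form `t` enters only through `φ`, so the derivative never touches the singular
kernel. -/
theorem hasDerivAt_shiftIntegral {a : ℝ} (ha : -1 < a) (ha' : a ≤ 0) (φ : SchwartzMap ℝ ℂ)
    (t : ℝ) :
    HasDerivAt (shiftIntegral a φ) (shiftIntegral a (SchwartzMap.derivCLM ℂ ℂ φ) t) t := by
  obtain ⟨C, hC0, hC⟩ := (SchwartzMap.derivCLM ℂ ℂ φ).exists_norm_add_le
  refine (hasDerivAt_integral_of_dominated_loc_of_deriv_le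
    (F := fun t s : ℝ => ((s ^ a : ℝ) : ℂ) * φ (s + t))
    (F' := fun t s : ℝ => ((s ^ a : ℝ) : ℂ) * SchwartzMap.derivCLM ℂ ℂ φ (s + t))
    (bound := fun s : ℝ => C * (2 + |t|) ^ 2 * (s ^ a * ((1 + s) ^ 2)⁻¹))
    (Metric.ball_mem_nhds t one_pos)
    (Eventually.of_forall fun t => aestronglyMeasurable_rpow_mul_shift a φ t)
    (integrableOn_rpow_mul_shift ha ha' φ t)
    (aestronglyMeasurable_rpow_mul_shift a _ t) ?_
    ((integrableOn_rpow_mul_one_add_sq_inv ha ha').const_mul _) ?_).2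
  · refine (ae_restrict_iff' measurableSet_Ioi).2 (Eventually.of_forall fun s hs x hx => ?_)
    have hs0 : 0 < s := hs
    have hx' : |x| ≤ 1 + |t| := by
      rw [Metric.mem_ball, Real.dist_eq] at hx
      have := abs_sub_abs_le_abs_sub x t
      linarith
    rw [norm_mul, Complex.norm_real, Real.norm_of_nonneg (by positivity), mul_left_comm]
    refine mul_le_mul_of_nonneg_left ((hC s x hs0.le).trans ?_) (by positivity)
    have h : 1 + |x| ≤ 2 + |t| := by linarith
    gcongr
  · refine Eventually.of_forall fun s x _ => ?_
    exact (((φ.hasDerivAt (s + x)).comp_const_add s x)).const_mul _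

theorem exists_pow_mul_norm_shiftIntegral_le {a : ℝ} (ha : -1 < a) (ha' : a ≤ 0)
    (φ : SchwartzMap ℝ ℂ) (n : ℕ) :
    ∃ C : ℝ, 0 ≤ C ∧ ∀ t : ℝ, 0 ≤ t → t ^ n * ‖shiftIntegral a φ t‖ ≤ C := by
  -- Of the `n + 2` powers, `n` absorb `t ^ n` and two make the integral in `s` converge.
  obtain ⟨C, hC0, hC⟩ := φ.exists_norm_le_inv_one_add_pow (n + 2)
  refine ⟨∫ s in Ioi (0 : ℝ), C * (s ^ a * ((1 + s) ^ 2)⁻¹),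
    setIntegral_nonneg measurableSet_Ioi fun s hs => ?_, fun t ht => ?_⟩
  · have hs0 : 0 < s := hs
    positivity
  have h1 : t ^ n * ‖shiftIntegral a φ t‖ =
      ‖∫ s in Ioi (0 : ℝ), ((t ^ n : ℝ) : ℂ) * (((s ^ a : ℝ) : ℂ) * φ (s + t))‖ := by
    rw [integral_const_mul, norm_mul, Complex.norm_real, Real.norm_of_nonneg (by positivity),
      shiftIntegral]
  rw [h1]
  refine norm_integral_le_of_norm_le
    ((integrableOn_rpow_mul_one_add_sq_inv ha ha').const_mul C) ?_
  refine (ae_restrict_iff' measurableSet_Ioi).2 (Eventually.of_forall fun s hs => ?_)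
  have hs0 : 0 < s := hs
  have h2 := hC (s + t)
  rw [abs_of_nonneg (by positivity)] at h2
  rw [norm_mul, norm_mul, Complex.norm_real, Complex.norm_real,
    Real.norm_of_nonneg (by positivity), Real.norm_of_nonneg (by positivity)]
  have h3 : t ^ n * ((1 + (s + t)) ^ (n + 2))⁻¹ ≤ ((1 + s) ^ 2)⁻¹ := by
    rw [pow_add, mul_inv, ← mul_assoc]
    refine (mul_le_mul ?_ (inv_anti₀ (by positivity) (pow_le_pow_left₀ (by positivity)
      (by linarith) 2)) (by positivity) zero_le_one).trans_eq (one_mul ((1 + s) ^ 2)⁻¹)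
    rw [← div_eq_mul_inv, div_le_one (by positivity)]
    exact pow_le_pow_left₀ ht (by linarith) n
  calc t ^ n * (s ^ a * ‖φ (s + t)‖)
      ≤ t ^ n * (s ^ a * (C * ((1 + (s + t)) ^ (n + 2))⁻¹)) := by gcongr
    _ = C * (s ^ a * (t ^ n * ((1 + (s + t)) ^ (n + 2))⁻¹)) := by ring
    _ ≤ C * (s ^ a * ((1 + s) ^ 2)⁻¹) := by gcongr

theorem shiftIntegral_zero_of_mem_fracTestSpace {α : ℝ} {φ : SchwartzMap ℝ ℂ}
    (hφ : φ ∈ fracTestSpace α) : shiftIntegral (-α) φ 0 = 0 := by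
  rw [← hφ.2 1 le_rfl, shiftIntegral]
  refine integral_congr_ae (Eventually.of_forall fun x => ?_)
  simp [mul_comm]

/-- This is where the moment conditions act: `Jφ` vanishes at `0` by the first one, and `(Jφ)' =
J(φ')` with `φ'` again a test function. Each use of the mean value inequality gains one power of
`t`, which is why `φ` is quantified inside the induction. -/
theorem exists_norm_shiftIntegral_le_mul_pow {α : ℝ} (hα0 : 0 ≤ α) (hα1 : α < 1) (n : ℕ) :
    ∀ φ ∈ fracTestSpace α, ∃ C : ℝ, 0 ≤ C ∧
      ∀ t : ℝ, 0 ≤ t → ‖shiftIntegral (-α) φ t‖ ≤ C * t ^ n := by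
  induction n with
  | zero =>
    intro φ _
    simpa using exists_pow_mul_norm_shiftIntegral_le (by linarith : -1 < -α) (by linarith) φ 0
  | succ n ih =>
    intro φ hφ
    obtain ⟨C, hC0, hC⟩ := ih _ (derivCLM_mem_fracTestSpace hφ)
    refine ⟨C, hC0, fun x hx => ?_⟩
    have h := norm_image_sub_le_of_norm_deriv_le_segment' (a := 0) (b := x)
      (f := shiftIntegral (-α) φ) (C := C * x ^ n)
      (fun y _ => (hasDerivAt_shiftIntegral (by linarith) (by linarith) φ y).hasDerivWithinAt)
      (fun y hy => (hC y hy.1).trans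
        (mul_le_mul_of_nonneg_left (pow_le_pow_left₀ hy.1 hy.2.le n) hC0))
      x (right_mem_Icc.2 hx)
    rw [shiftIntegral_zero_of_mem_fracTestSpace hφ, sub_zero, sub_zero] at h
    rw [pow_succ, ← mul_assoc]
    exact h

theorem rapidlyDecaying_shiftIntegral {α : ℝ} (hα0 : 0 ≤ α) (hα1 : α < 1)
    {φ : SchwartzMap ℝ ℂ} (hφ : φ ∈ fracTestSpace α) :
    RapidlyDecaying (shiftIntegral (-α) φ) := by
  have h1 : -1 < -α := by linarith
  have h2 : -α ≤ 0 := by linarith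
  refine ⟨fun x _ => (hasDerivAt_shiftIntegral h1 h2 φ x).continuousAt.continuousWithinAt,
    fun n => ?_⟩
  obtain ⟨C, -, hC⟩ := exists_norm_shiftIntegral_le_mul_pow hα0 hα1 n φ hφ
  obtain ⟨D, -, hD⟩ := exists_pow_mul_norm_shiftIntegral_le h1 h2 φ n
  refine ⟨max C D, fun x hx => ⟨(hC x hx.le).trans ?_, (hD x hx.le).trans (le_max_right _ _)⟩⟩
  exact mul_le_mul_of_nonneg_right (le_max_left _ _) (by positivity)

/-! ### Beta integrals and the Mellin transform of the fractional integral -/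

theorem norm_ofReal_cpow_mul_ofReal_rpow {x τ : ℝ} (hx : x ∈ Ioo 0 τ) (s : ℂ) (a : ℝ) :
    ‖(x : ℂ) ^ (s - 1) * (((τ - x) ^ a : ℝ) : ℂ)‖ = x ^ (s.re - 1) * (τ - x) ^ a := by
  rw [norm_mul, Complex.norm_real, Complex.norm_cpow_eq_rpow_re_of_pos hx.1,
    Real.norm_of_nonneg (Real.rpow_nonneg (sub_nonneg.2 hx.2.le) _)]
  simp

theorem setIntegral_cpow_mul_rpow_sub (s : ℂ) (α : ℝ) {τ : ℝ} (hτ : 0 < τ) :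
    ∫ x in Ioo 0 τ, (x : ℂ) ^ (s - 1) * (((τ - x) ^ (-α) : ℝ) : ℂ) =
      (τ : ℂ) ^ (s - α) * Complex.betaIntegral s (1 - α) := by
  have h := Complex.betaIntegral_scaled s (1 - α) hτ
  rw [intervalIntegral.integral_of_le hτ.le, integral_Ioc_eq_integral_Ioo,
    show s + (1 - (α : ℂ)) - 1 = s - α by ring] at h
  rw [← h]
  refine setIntegral_congr_fun measurableSet_Ioo fun x hx => ?_
  rw [Complex.ofReal_cpow (sub_nonneg.2 hx.2.le)]
  push_cast
  congr 2
  ring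

theorem setIntegral_rpow_mul_rpow_sub (σ α : ℝ) {τ : ℝ} (hτ : 0 < τ) :
    ∫ x in Ioo 0 τ, x ^ (σ - 1) * (τ - x) ^ (-α) =
      τ ^ (σ - α) * ‖Complex.betaIntegral σ (1 - α)‖ := by
  have h := congrArg norm (setIntegral_cpow_mul_rpow_sub σ α hτ)
  rw [norm_mul, Complex.norm_cpow_eq_rpow_re_of_pos hτ] at h
  have h1 : ∫ x in Ioo 0 τ, (x : ℂ) ^ ((σ : ℂ) - 1) * (((τ - x) ^ (-α) : ℝ) : ℂ) =
      ((∫ x in Ioo 0 τ, x ^ (σ - 1) * (τ - x) ^ (-α) : ℝ) : ℂ) := by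
    rw [← integral_complex_ofReal]
    refine setIntegral_congr_fun measurableSet_Ioo fun x hx => ?_
    push_cast [Complex.ofReal_cpow hx.1.le]
    rfl
  rw [h1, Complex.norm_real, Real.norm_of_nonneg] at h
  · simpa using h
  · refine setIntegral_nonneg measurableSet_Ioo fun x hx => ?_
    have := hx.1
    have := sub_pos.2 hx.2
    positivity

theorem betaIntegral_ne_zero {s t : ℂ} (hs : 0 < s.re) (ht : 0 < t.re) :
    Complex.betaIntegral s t ≠ 0 := by
  intro h
  have h1 := Complex.Gamma_mul_Gamma_eq_betaIntegral hs ht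
  rw [h, mul_zero] at h1
  exact mul_ne_zero (Complex.Gamma_ne_zero_of_re_pos hs) (Complex.Gamma_ne_zero_of_re_pos ht) h1

theorem integrableOn_rpow_mul_rpow_sub {σ α τ : ℝ} (hσ : 0 < σ) (hα : α < 1) (hτ : 0 < τ) :
    IntegrableOn (fun x : ℝ => x ^ (σ - 1) * (τ - x) ^ (-α)) (Ioo 0 τ) := by
  -- A non-integrable function has integral `0` by convention, so a nonzero value of the integral
  -- proves integrability.
  refine not_imp_comm.1 integral_undef ?_
  rw [setIntegral_rpow_mul_rpow_sub σ α hτ]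
  refine mul_ne_zero (Real.rpow_pos_of_pos hτ _).ne' (norm_ne_zero_iff.2 ?_)
  exact betaIntegral_ne_zero (by simpa using hσ) (by simpa using hα)

/-- The Mellin transform of a right-sided fractional integral, in its half-plane of absolute
convergence. -/
theorem mellin_shiftIntegral {α : ℝ} (hα : α < 1) {φ : SchwartzMap ℝ ℂ} (hφ : φ ∈ schwartzPlus)
    {s : ℂ} (hs : 0 < s.re) :
    mellin (shiftIntegral (-α) φ) s = Complex.betaIntegral s (1 - α) * mellin φ (s + 1 - α) := by
  set H : ℝ × ℝ → ℂ := indicator {p : ℝ × ℝ | p.1 < p.2} fun p =>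
    (p.1 : ℂ) ^ (s - 1) * (((p.2 - p.1) ^ (-α) : ℝ) : ℂ) * φ p.2 with hH
  have hmeas : Measurable H := by
    refine Measurable.indicator ?_ (measurableSet_lt measurable_fst measurable_snd)
    refine Measurable.mul (Measurable.mul ?_ ?_) (φ.continuous.measurable.comp measurable_snd)
    · exact (Complex.measurable_ofReal.comp measurable_fst).pow_const _
    · exact Complex.measurable_ofReal.comp ((measurable_snd.sub measurable_fst).pow_const _)
  have hsec : ∀ τ : ℝ, (fun x => H (x, τ)) = indicator (Iio τ) fun x =>
      (x : ℂ) ^ (s - 1) * (((τ - x) ^ (-α) : ℝ) : ℂ) * φ τ := fun τ => by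
    ext x
    simp [hH, indicator]
  have hnorm : ∀ τ : ℝ, 0 < τ → ∫ x in Ioi (0 : ℝ), ‖H (x, τ)‖ =
      ‖Complex.betaIntegral s.re (1 - α)‖ * ‖φ τ * ((τ ^ (s.re - α) : ℝ) : ℂ)‖ := by
    intro τ hτ
    have h1 : ∀ x, ‖H (x, τ)‖ = indicator (Iio τ) (fun x =>
        ‖(x : ℂ) ^ (s - 1) * (((τ - x) ^ (-α) : ℝ) : ℂ) * φ τ‖) x := fun x => by
      rw [congrFun (hsec τ) x, norm_indicator_eq_indicator_norm]
    simp only [h1]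
    rw [setIntegral_indicator measurableSet_Iio, Ioi_inter_Iio]
    simp only [norm_mul _ (φ τ)]
    rw [integral_mul_const, setIntegral_congr_fun measurableSet_Ioo
      (fun x hx => norm_ofReal_cpow_mul_ofReal_rpow hx s (-α)),
      setIntegral_rpow_mul_rpow_sub _ _ hτ, norm_mul (φ τ), Complex.norm_real,
      Real.norm_of_nonneg (by positivity)]
    ring
  -- Tonelli: integrating `‖H‖` in `x` first leaves a constant times an absolute moment of `φ`,
  -- which is finite.
  have hint : Integrable H ((volume.restrict (Ioi 0)).prod (volume.restrict (Ioi 0))) := by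
    refine (integrable_prod_iff' hmeas.aestronglyMeasurable).2 ⟨?_, ?_⟩
    · refine (ae_restrict_iff' measurableSet_Ioi).2 (Eventually.of_forall fun τ hτ => ?_)
      have hτ : 0 < τ := hτ
      rw [hsec τ, integrable_indicator_iff measurableSet_Iio, IntegrableOn,
        Measure.restrict_restrict measurableSet_Iio, inter_comm, Ioi_inter_Iio]
      refine Integrable.mul_const ?_ _
      refine Integrable.mono' (integrableOn_rpow_mul_rpow_sub hs hα hτ)
        (Measurable.aestronglyMeasurable ?_) ?_
      · exact (Complex.measurable_ofReal.pow_const _).mul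
          (Complex.measurable_ofReal.comp ((measurable_const.sub measurable_id).pow_const _))
      · refine (ae_restrict_iff' measurableSet_Ioo).2 (Eventually.of_forall fun x hx => ?_)
        exact (norm_ofReal_cpow_mul_ofReal_rpow hx s (-α)).le
    · refine IntegrableOn.congr_fun
        ((schwartzPlus_integrableOn_moment hφ (s.re - α)).norm.const_mul _)
        (fun τ hτ => (hnorm τ hτ).symm) measurableSet_Ioi
  calc mellin (shiftIntegral (-α) φ) s
      = ∫ x in Ioi (0 : ℝ), ∫ τ in Ioi (0 : ℝ), H (x, τ) := by
        refine setIntegral_congr_fun measurableSet_Ioi fun x hx => ?_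
        have hx : 0 < x := hx
        have h1 : ∀ τ, H (x, τ) = indicator (Ioi x) (fun τ =>
            (x : ℂ) ^ (s - 1) * ((((τ - x) ^ (-α) : ℝ) : ℂ) * φ τ)) τ := fun τ => by
          simp [hH, indicator, mul_assoc]
        simp only [h1]
        rw [setIntegral_indicator measurableSet_Ioi, inter_eq_right.2 (Ioi_subset_Ioi hx.le),
          integral_const_mul, shiftIntegral_eq_setIntegral_Ioi, smul_eq_mul]
    _ = ∫ τ in Ioi (0 : ℝ), ∫ x in Ioi (0 : ℝ), H (x, τ) := integral_integral_swap hint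
    _ = ∫ τ in Ioi (0 : ℝ), Complex.betaIntegral s (1 - α) *
          ((τ : ℂ) ^ (s + 1 - α - 1) • φ τ) := by
        refine setIntegral_congr_fun measurableSet_Ioi fun τ hτ => ?_
        simp only [hsec τ]
        rw [setIntegral_indicator measurableSet_Iio, Ioi_inter_Iio, integral_mul_const,
          setIntegral_cpow_mul_rpow_sub s α hτ, smul_eq_mul,
          show s + 1 - (α : ℂ) - 1 = s - α by ring]
        ring
    _ = _ := by rw [integral_const_mul, mellin]

/-- The analytic continuation of `mellin_shiftIntegral` to the whole plane. -/
theorem inv_Gamma_mul_mellin_shiftIntegral {α : ℝ} (hα0 : 0 ≤ α) (hα1 : α < 1)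
    {φ : SchwartzMap ℝ ℂ} (hφ : φ ∈ fracTestSpace α) (s : ℂ) :
    (Complex.Gamma s)⁻¹ * mellin (shiftIntegral (-α) φ) s =
      Complex.Gamma (1 - α) * ((Complex.Gamma (s + 1 - α))⁻¹ * mellin φ (s + 1 - α)) := by
  -- Using `1/Γ` instead of `Γ` keeps both sides entire; the value `0` for `Γ` at its poles makes
  -- the inverse correct there.
  have hA : Differentiable ℂ fun s : ℂ =>
      (Complex.Gamma s)⁻¹ * mellin (shiftIntegral (-α) φ) s :=
    Complex.differentiable_one_div_Gamma.mul
      (rapidlyDecaying_shiftIntegral hα0 hα1 hφ).differentiable_mellin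
  have hB : Differentiable ℂ fun s : ℂ =>
      Complex.Gamma (1 - α) * ((Complex.Gamma (s + 1 - α))⁻¹ * mellin φ (s + 1 - α)) :=
    ((Complex.differentiable_one_div_Gamma.mul
      (rapidlyDecaying_of_mem_schwartzPlus hφ.1).differentiable_mellin).comp
        (by fun_prop : Differentiable ℂ fun s : ℂ => s + 1 - (α : ℂ))).const_mul _
  refine congrFun (AnalyticOnNhd.eq_of_eventuallyEq (z₀ := 1)
    (hA.differentiableOn.analyticOnNhd isOpen_univ)
    (hB.differentiableOn.analyticOnNhd isOpen_univ) ?_) s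
  have hopen : IsOpen {z : ℂ | 0 < z.re} := isOpen_lt continuous_const Complex.continuous_re
  filter_upwards [hopen.mem_nhds (by simp : (1 : ℂ) ∈ {z : ℂ | 0 < z.re})] with z hz
  have hz : 0 < z.re := hz
  have h1 : 0 < (1 - (α : ℂ)).re := by simpa using hα1
  have h2 : 0 < (z + 1 - (α : ℂ)).re := by simp; linarith
  have hG := Complex.Gamma_mul_Gamma_eq_betaIntegral hz h1
  rw [← add_sub_assoc] at hG
  have hz0 := Complex.Gamma_ne_zero_of_re_pos hz
  have hz1 := Complex.Gamma_ne_zero_of_re_pos h2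
  rw [mellin_shiftIntegral hα1 hφ.1 hz]
  field_simp
  linear_combination (-mellin φ (z + 1 - α)) * hG

/-- Differentiate `1/Γ(s) = s/Γ(s+1)`. At `-(k+1)` the term with `1/Γ(-k) = 0` drops out, so each
step multiplies the derivative by `-(k+1)`. -/
theorem hasDerivAt_inv_Gamma_neg_nat (k : ℕ) :
    HasDerivAt (fun s : ℂ => (Complex.Gamma s)⁻¹) ((-1) ^ k * (k.factorial : ℂ)) (-(k : ℂ)) := by
  induction k with
  | zero =>
    have h := (hasDerivAt_id (0 : ℂ)).mul
      ((Complex.differentiable_one_div_Gamma (0 + 1)).hasDerivAt.comp_add_const 0 1)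
    rw [funext Complex.one_div_Gamma_eq_self_mul_one_div_Gamma_add_one]
    convert! h using 1
    · simp
    · simp
  | succ k ih =>
    have e : -((k + 1 : ℕ) : ℂ) + 1 = -(k : ℂ) := by push_cast; ring
    rw [← e] at ih
    have h := (hasDerivAt_id (-((k + 1 : ℕ) : ℂ))).mul (ih.comp_add_const _ 1)
    rw [funext Complex.one_div_Gamma_eq_self_mul_one_div_Gamma_add_one]
    convert! h using 1
    rw [e, Complex.Gamma_neg_nat_eq_zero, Nat.factorial_succ, id]
    push_cast
    ring

/-! ### Continuity of functionals given by functions -/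

/-- The explicit seminorm as constant, rather than a mere existence statement, is what yields
continuity in `φ`. -/
theorem norm_iteratedDeriv_le_seminorm_mul_pow {φ : SchwartzMap ℝ ℂ} (hφ : φ ∈ schwartzPlus)
    (n : ℕ) : ∀ m : ℕ, ∀ x : ℝ, 0 ≤ x →
      ‖iteratedDeriv m φ x‖ ≤ SchwartzMap.seminorm ℂ 0 (m + n) φ * x ^ n := by
  induction n with
  | zero =>
    intro m x _
    simpa [norm_iteratedFDeriv_eq_norm_iteratedDeriv] using
      SchwartzMap.norm_iteratedFDeriv_le_seminorm ℂ φ m x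
  | succ n ih =>
    intro m x hx
    have hd : ∀ y : ℝ, HasDerivAt (iteratedDeriv m φ) (iteratedDeriv (m + 1) φ y) y := by
      intro y
      rw [iteratedDeriv_succ]
      exact ((φ.smooth ⊤).differentiable_iteratedDeriv m
        (by exact_mod_cast WithTop.coe_lt_top _) y).hasDerivAt
    have h := norm_image_sub_le_of_norm_deriv_le_segment' (a := 0) (b := x)
      (f := iteratedDeriv m φ) (f' := iteratedDeriv (m + 1) φ)
      (C := SchwartzMap.seminorm ℂ 0 (m + (n + 1)) φ * x ^ n)
      (fun y _ => (hd y).hasDerivWithinAt)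
      (fun y hy => by
        have h1 := ih (m + 1) y hy.1
        rw [show m + 1 + n = m + (n + 1) by ring] at h1
        exact h1.trans
          (mul_le_mul_of_nonneg_left (pow_le_pow_left₀ hy.1 hy.2.le n) (apply_nonneg _ _)))
      x (right_mem_Icc.2 hx)
    rw [schwartzPlus_iteratedDeriv_zero hφ, sub_zero, sub_zero] at h
    rw [pow_succ, ← mul_assoc]
    exact h

/-- A power function is bounded against `schwartzPlus` by a continuous seminorm, with an integrable
weight. -/
theorem rpow_mul_norm_schwartzPlus_le {a : ℝ} {n : ℕ} (hn : |a| + 2 ≤ n) {φ : SchwartzMap ℝ ℂ}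
    (hφ : φ ∈ schwartzPlus) {x : ℝ} (hx : 0 < x) :
    x ^ a * ‖φ x‖ ≤
      (SchwartzMap.seminorm ℂ 0 n φ + SchwartzMap.seminorm ℂ n 0 φ) * (2 * (1 + x ^ 2)⁻¹) := by
  have hS1 : 0 ≤ SchwartzMap.seminorm ℂ 0 n φ := apply_nonneg _ _
  have hS2 : 0 ≤ SchwartzMap.seminorm ℂ n 0 φ := apply_nonneg _ _
  -- Near `0` flatness supplies `x ^ n`, at infinity decay supplies `x ^ (-n)`; the two spare powers
  -- in `n` leave an integrable weight.
  rcases le_or_gt x 1 with h1 | h1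
  · have h := norm_iteratedDeriv_le_seminorm_mul_pow hφ n 0 x hx.le
    rw [iteratedDeriv_zero, zero_add] at h
    have hw : 1 ≤ 2 * (1 + x ^ 2)⁻¹ := by
      rw [← div_eq_mul_inv, one_le_div (by positivity)]
      nlinarith
    calc x ^ a * ‖φ x‖ ≤ x ^ a * (SchwartzMap.seminorm ℂ 0 n φ * x ^ n) := by gcongr
      _ = SchwartzMap.seminorm ℂ 0 n φ * x ^ (a + n) := by
        rw [Real.rpow_add hx, Real.rpow_natCast]; ring
      _ ≤ (SchwartzMap.seminorm ℂ 0 n φ + SchwartzMap.seminorm ℂ n 0 φ) * 1 := by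
        gcongr
        · linarith
        · exact Real.rpow_le_one hx.le h1 (by linarith [neg_abs_le a])
      _ ≤ _ := by gcongr
  · have h := SchwartzMap.norm_pow_mul_le_seminorm ℂ φ n x
    rw [Real.norm_of_nonneg hx.le] at h
    have hw : x ^ (-2 : ℝ) ≤ 2 * (1 + x ^ 2)⁻¹ := by
      rw [Real.rpow_neg hx.le, ← div_eq_mul_inv, le_div_iff₀ (by positivity),
        inv_mul_le_iff₀ (by positivity)]
      norm_num
      nlinarith
    calc x ^ a * ‖φ x‖ = (x ^ n * ‖φ x‖) * x ^ (a - n) := by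
          rw [Real.rpow_sub hx, Real.rpow_natCast]; field_simp
      _ ≤ (SchwartzMap.seminorm ℂ 0 n φ + SchwartzMap.seminorm ℂ n 0 φ) * x ^ (-2 : ℝ) := by
        gcongr
        · linarith
        · exact h1.le
        · linarith [le_abs_self a]
      _ ≤ _ := by gcongr

/-- A continuous function on `(0, ∞)` of at most power-like growth defines a distribution. -/
theorem exists_isGivenByFunction (α : ℝ) {f : ℝ → ℂ} (hf : ContinuousOn f (Ioi 0)) {a b : ℝ}
    (hab : ∀ x : ℝ, 0 < x → ‖f x‖ ≤ x ^ a + x ^ b) :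
    ∃ R : FracDistribution α, IsGivenByFunction α f R := by
  obtain ⟨n, hn⟩ := exists_nat_ge (max (|a| + 2) (|b| + 2))
  set p : SchwartzMap ℝ ℂ → ℝ := fun φ =>
    SchwartzMap.seminorm ℂ 0 n φ + SchwartzMap.seminorm ℂ n 0 φ with hp
  have hpc : Continuous p :=
    ((schwartz_withSeminorms ℂ ℝ ℂ).continuous_seminorm (0, n)).add
      ((schwartz_withSeminorms ℂ ℝ ℂ).continuous_seminorm (n, 0))
  have hbound : ∀ φ ∈ schwartzPlus, ∀ x : ℝ, 0 < x →
      ‖f x * φ x‖ ≤ p φ * (4 * (1 + x ^ 2)⁻¹) := fun φ hφ x hx => by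
    have h1 := rpow_mul_norm_schwartzPlus_le ((le_max_left _ _).trans hn) hφ hx
    have h2 := rpow_mul_norm_schwartzPlus_le ((le_max_right _ _).trans hn) hφ hx
    rw [norm_mul]
    calc ‖f x‖ * ‖φ x‖ ≤ (x ^ a + x ^ b) * ‖φ x‖ := by gcongr; exact hab x hx
      _ = x ^ a * ‖φ x‖ + x ^ b * ‖φ x‖ := by ring
      _ ≤ _ := add_le_add h1 h2
      _ = _ := by simp only [hp]; ring
  have hw : IntegrableOn (fun x : ℝ => 4 * (1 + x ^ 2)⁻¹) (Ioi 0) :=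
    (integrable_inv_one_add_sq.const_mul 4).integrableOn
  have hbound' : ∀ φ ∈ schwartzPlus, ∀ᵐ x ∂volume.restrict (Ioi (0 : ℝ)),
      ‖f x * φ x‖ ≤ p φ * (4 * (1 + x ^ 2)⁻¹) := fun φ hφ =>
    (ae_restrict_iff' measurableSet_Ioi).2 (Eventually.of_forall fun x hx => hbound φ hφ x hx)
  have hint : ∀ φ ∈ schwartzPlus, IntegrableOn (fun x : ℝ => f x * φ x) (Ioi 0) := fun φ hφ =>
    Integrable.mono' (hw.const_mul (p φ))
      ((hf.mul φ.continuous.continuousOn).aestronglyMeasurable measurableSet_Ioi) (hbound' φ hφ)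
  let L : fracTestSpace α →ₗ[ℂ] ℂ :=
    { toFun := fun φ => ∫ t in Ioi (0 : ℝ), f t * φ.1 t
      map_add' := fun φ ψ => by
        rw [← integral_add (hint φ.1 φ.2.1) (hint ψ.1 ψ.2.1)]
        simp [mul_add]
      map_smul' := fun c φ => by
        rw [RingHom.id_apply, smul_eq_mul, ← integral_const_mul]
        simp [mul_left_comm] }
  have hL : ∀ φ, ‖L φ‖ ≤ p φ.1 * ∫ x in Ioi (0 : ℝ), 4 * (1 + x ^ 2)⁻¹ := fun φ => by
    rw [← integral_const_mul]
    exact norm_integral_le_of_norm_le (hw.const_mul _) (hbound' φ.1 φ.2.1)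
  have hcont : Continuous L := by
    refine continuous_of_continuousAt_zero L ?_
    rw [ContinuousAt, map_zero]
    refine squeeze_zero_norm hL ?_
    have h := ((hpc.comp continuous_subtype_val).mul_const
      (∫ x in Ioi (0 : ℝ), 4 * (1 + x ^ 2)⁻¹)).tendsto (0 : fracTestSpace α)
    simpa [hp] using h
  exact ⟨⟨L, hcont⟩, fun φ => ⟨hint φ.1 φ.2.1, rfl⟩⟩

/-! ### Derivatives of powers as Mellin transforms, and the conclusion -/

theorem mellin_ofReal (f : ℝ → ℂ) (a : ℝ) :
    mellin f a = ∫ x in Ioi (0 : ℝ), ((x ^ (a - 1) : ℝ) : ℂ) * f x := by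
  refine setIntegral_congr_fun measurableSet_Ioi fun x hx => ?_
  rw [Complex.ofReal_cpow (le_of_lt hx), smul_eq_mul]
  push_cast
  rfl

theorem RapidlyDecaying.integrableOn_rpow_mul {f : ℝ → ℂ} (hf : RapidlyDecaying f) (a : ℝ) :
    IntegrableOn (fun x : ℝ => ((x ^ (a - 1) : ℝ) : ℂ) * f x) (Ioi 0) := by
  refine IntegrableOn.congr_fun (hf.mellinConvergent a) (fun x hx => ?_) measurableSet_Ioi
  rw [Complex.ofReal_cpow (le_of_lt hx), smul_eq_mul]
  push_cast
  rfl

theorem hasDerivAt_ofReal_rpow (μ : ℝ) {x : ℝ} (hx : 0 < x) :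
    HasDerivAt (fun t : ℝ => ((t ^ μ : ℝ) : ℂ)) ((μ : ℂ) * ((x ^ (μ - 1) : ℝ) : ℂ)) x := by
  have h := (Real.hasDerivAt_rpow_const (p := μ) (Or.inl hx.ne')).ofReal_comp
  rwa [Complex.ofReal_mul] at h

/-- Characterization of the Caputo derivative of a power by Mellin transforms. -/
theorem isCaputoDerivative_rpow {α : ℝ} (hα0 : 0 ≤ α) (hα1 : α < 1) (μ : ℝ)
    {T : FracDistribution α}
    (hT : ∀ φ : fracTestSpace α,
      T φ = μ * (Complex.Gamma (1 - α))⁻¹ * mellin (shiftIntegral (-α) φ.1) μ) :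
    IsCaputoDerivative α (fun t : ℝ => ((t ^ μ : ℝ) : ℂ)) T := by
  refine ⟨?_, ⟨|μ|, μ - 1, fun x hx => ?_⟩, fun φ => ?_⟩
  · exact Complex.ofRealCLM.contDiff.comp_contDiffOn fun x hx =>
      (Real.contDiffAt_rpow_const_of_ne (ne_of_gt hx)).contDiffWithinAt
  · rw [(hasDerivAt_ofReal_rpow μ hx).deriv, norm_mul, Complex.norm_real, Complex.norm_real,
      Real.norm_eq_abs, Real.norm_of_nonneg (by positivity)]
    gcongr
    have : 0 ≤ x ^ (-(μ - 1)) := by positivity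
    linarith
  · have he : EqOn (fun x : ℝ => (μ * (Complex.Gamma (1 - α))⁻¹) *
        (((x ^ (μ - 1) : ℝ) : ℂ) * shiftIntegral (-α) φ.1 x))
        (fun x : ℝ => deriv (fun t : ℝ => ((t ^ μ : ℝ) : ℂ)) x *
          fracIntegralRight (1 - α) φ.1 x) (Ioi 0) := fun x hx => by
      simp only
      rw [(hasDerivAt_ofReal_rpow μ hx).deriv, fracIntegralRight_eq_shiftIntegral,
        show 1 - α - 1 = -α by ring, ← Complex.Gamma_ofReal]
      push_cast
      ring
    have hr := rapidlyDecaying_shiftIntegral hα0 hα1 φ.2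
    refine ⟨IntegrableOn.congr_fun ((hr.integrableOn_rpow_mul μ).const_mul _) he
      measurableSet_Ioi, ?_⟩
    rw [← setIntegral_congr_fun measurableSet_Ioi he, integral_const_mul, hT, mellin_ofReal]

theorem continuousOn_ofReal_rpow (a : ℝ) :
    ContinuousOn (fun t : ℝ => ((t ^ a : ℝ) : ℂ)) (Ioi 0) :=
  fun _ hx => (hasDerivAt_ofReal_rpow a hx).continuousAt.continuousWithinAt

theorem Real.abs_log_le_add_inv {x : ℝ} (hx : 0 < x) : |Real.log x| ≤ x + x⁻¹ := by
  have h1 := Real.log_le_sub_one_of_pos hx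
  have h2 := Real.log_le_sub_one_of_pos (inv_pos.2 hx)
  rw [Real.log_inv] at h2
  have : 0 < x⁻¹ := inv_pos.2 hx
  exact abs_le.2 ⟨by linarith, by linarith⟩

/-- The continued identity is `0 = 0` at `s = -k`, so its derivative is taken there. By the product
rule only one term survives on each side, because `1/Γ(-k)` and the moment `Mφ(-k+1-α)` both vanish.
-/
theorem neg_nat_mul_mellin_shiftIntegral {α : ℝ} (hα0 : 0 < α) (hα1 : α < 1)
    {φ : SchwartzMap ℝ ℂ} (hφ : φ ∈ fracTestSpace α) (k : ℕ) :
    (-1) ^ k * (k.factorial : ℂ) * mellin (shiftIntegral (-α) φ) (-(k : ℂ)) =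
      Complex.Gamma (1 - α) * ((Complex.Gamma (-(k : ℂ) + 1 - α))⁻¹ *
        mellin (fun t => Real.log t • φ t) (-(k : ℂ) + 1 - α)) := by
  have hφr := rapidlyDecaying_of_mem_schwartzPlus hφ.1
  have hA := (hasDerivAt_inv_Gamma_neg_nat k).mul
    ((rapidlyDecaying_shiftIntegral hα0.le hα1 hφ).hasDerivAt_mellin (-(k : ℂ))).2
  have hshift : HasDerivAt (fun s : ℂ => s + 1 - (α : ℂ)) 1 (-(k : ℂ)) :=
    ((hasDerivAt_id _).add_const _).sub_const _
  have hB := (((Complex.differentiable_one_div_Gamma _).hasDerivAt.mul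
    (hφr.hasDerivAt_mellin (-(k : ℂ) + 1 - α)).2).comp (-(k : ℂ)) hshift).const_mul
      (Complex.Gamma (1 - α))
  have h := (hA.congr_of_eventuallyEq (Eventually.of_forall fun s =>
    (inv_Gamma_mul_mellin_shiftIntegral hα0.le hα1 hφ s).symm)).unique hB
  have hm : mellin φ (-(k : ℂ) + 1 - α) = 0 := by
    have e : (-(k : ℂ) + 1 - α) = ((-(k : ℝ) + 1 - α : ℝ) : ℂ) := by push_cast; rfl
    rw [e, mellin_ofReal, ← hφ.2 (k + 1) (by omega)]
    refine setIntegral_congr_fun measurableSet_Ioi fun x _ => ?_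
    rw [mul_comm, show -(k : ℝ) + 1 - α - 1 = 1 - α - ((k + 1 : ℕ) : ℝ) by push_cast; ring]
  simpa [hm, Complex.Gamma_neg_nat_eq_zero] using h

theorem proposition3 (α : ℝ) (hα0 : 0 < α) (hα1 : α < 1) :
    (∀ μ : ℝ, μ < 0 → (∀ n : ℕ, 1 ≤ n → μ ≠ -(n : ℝ)) →
      ∃ T R : FracDistribution α,
        IsCaputoDerivative α (fun t : ℝ => ((t ^ μ : ℝ) : ℂ)) T ∧
        IsGivenByFunction α (fun t : ℝ => ((t ^ (μ - α) : ℝ) : ℂ)) R ∧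
        T = ((Real.Gamma (μ + 1) / Real.Gamma (μ + 1 - α) : ℝ) : ℂ) • R) ∧
    (∀ k : ℕ, 1 ≤ k →
      ∃ T R : FracDistribution α,
        IsCaputoDerivative α (fun t : ℝ => ((t ^ (-(k : ℝ)) : ℝ) : ℂ)) T ∧
        IsGivenByFunction α
          (fun t : ℝ => ((t ^ (-(k : ℝ) - α) * Real.log t : ℝ) : ℂ)) R ∧
        T = (((-1) ^ (k - 1) /
          (((k - 1).factorial : ℝ) * Real.Gamma (-(k : ℝ) + 1 - α)) : ℝ) : ℂ) • R) := by
  have hΓα : Complex.Gamma (1 - α) ≠ 0 :=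
    Complex.Gamma_ne_zero_of_re_pos (by simpa using hα1)
  refine ⟨fun μ hμ hμn => ?_, fun k hk => ?_⟩
  · obtain ⟨R, hR⟩ := exists_isGivenByFunction α (continuousOn_ofReal_rpow (μ - α))
      (a := μ - α) (b := μ - α) fun x hx => by
        have : 0 < x ^ (μ - α) := by positivity
        rw [Complex.norm_real, Real.norm_of_nonneg this.le]
        linarith
    -- `T` is defined as the multiple of `R`, so its continuity is free and only the value on each
    -- `φ` remains to be checked.
    refine ⟨_, R, isCaputoDerivative_rpow hα0.le hα1 μ fun φ => ?_, hR, rfl⟩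
    have hΓμ : Complex.Gamma μ ≠ 0 := Complex.Gamma_ne_zero fun m hm => by
      have hm' : μ = -(m : ℝ) := by exact_mod_cast hm
      rcases Nat.eq_zero_or_pos m with rfl | h
      · simp at hm'
        exact hμ.ne hm'
      · exact hμn m h hm'
    have hRφ : R φ = mellin φ.1 (μ + 1 - α) := by
      have e : ((μ : ℂ) + 1 - α) = ((μ + 1 - α : ℝ) : ℂ) := by push_cast; rfl
      rw [(hR φ).2, e, mellin_ofReal, show μ + 1 - α - 1 = μ - α by ring]
    have h := inv_Gamma_mul_mellin_shiftIntegral hα0.le hα1 φ.2 μ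
    rw [inv_mul_eq_iff_eq_mul₀ hΓμ] at h
    rw [h, smul_apply, hRφ, smul_eq_mul, Complex.ofReal_div,
      ← Complex.Gamma_ofReal, ← Complex.Gamma_ofReal, div_eq_mul_inv]
    push_cast
    rw [Complex.Gamma_add_one _ (by exact_mod_cast hμ.ne)]
    field_simp
  · obtain ⟨R, hR⟩ := exists_isGivenByFunction α
      (f := fun t : ℝ => ((t ^ (-(k : ℝ) - α) * Real.log t : ℝ) : ℂ))
      (a := -(k : ℝ) - α + 1) (b := -(k : ℝ) - α - 1)
      (by
        simp only [Complex.ofReal_mul]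
        refine (continuousOn_ofReal_rpow _).mul (Complex.continuous_ofReal.comp_continuousOn ?_)
        exact fun x hx => (Real.continuousAt_log (ne_of_gt hx)).continuousWithinAt)
      -- The bound `|log x| ≤ x + x⁻¹` accounts for the exponents `-k-α±1`.
      fun x hx => by
        rw [Complex.norm_real, norm_mul, Real.norm_of_nonneg (by positivity), Real.norm_eq_abs,
          Real.rpow_add hx, Real.rpow_sub hx _ 1, Real.rpow_one, div_eq_mul_inv, ← mul_add]
        gcongr
        exact Real.abs_log_le_add_inv hx
    refine ⟨_, R, isCaputoDerivative_rpow hα0.le hα1 _ fun φ => ?_, hR, rfl⟩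
    have hRφ : R φ = mellin (fun t => Real.log t • φ.1 t) (-(k : ℂ) + 1 - α) := by
      have e : (-(k : ℂ) + 1 - α) = ((-(k : ℝ) + 1 - α : ℝ) : ℂ) := by push_cast; rfl
      rw [(hR φ).2, e, mellin_ofReal, show -(k : ℝ) + 1 - α - 1 = -(k : ℝ) - α by ring]
      refine setIntegral_congr_fun measurableSet_Ioi fun x _ => ?_
      simp [mul_assoc]
    have h := neg_nat_mul_mellin_shiftIntegral hα0 hα1 φ.2 k
    -- With `k = j + 1`, the factor `-k` from `u'` cancels against `k!` and the sign `(-1)^k`,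
    -- leaving `(-1)^j / j!`.
    obtain ⟨j, rfl⟩ := Nat.exists_eq_add_of_le' hk
    have hj : (j.factorial : ℂ) ≠ 0 := by exact_mod_cast j.factorial_ne_zero
    have hj1 : (j + 1 : ℂ) ≠ 0 := by exact_mod_cast j.succ_ne_zero
    rw [← hRφ, Nat.factorial_succ] at h
    rw [smul_apply, smul_eq_mul, Nat.add_sub_cancel]
    push_cast [← Complex.Gamma_ofReal] at h ⊢
    have hsq : ((-1 : ℂ) ^ j) * (-1) ^ j = 1 := by rw [← mul_pow]; simp
    rw [mul_comm (Complex.Gamma (1 - α)), ← div_eq_iff hΓα] at h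
    rw [div_mul_eq_mul_div, mul_comm (j.factorial : ℂ), ← div_div, mul_div_assoc,
      div_eq_inv_mul (R φ), ← h, pow_succ, div_eq_iff hj]
    linear_combination (-(Complex.Gamma (1 - α))⁻¹ * (j + 1) * j.factorial *
      mellin (shiftIntegral (-α) φ.1) (-(j + 1 : ℂ))) * hsq
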